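/- Let $q$ be a prime power, let $n\ge 1$, and regard $\mathbb F_{q^n}$ as an $n$-dimensional $\mathbb F_q$-vector space. Let $B$ be a nondegenerate symmetric $\mathbb F_q$-bilinear form on $\mathbb F_{q^n}$. Let $t(B)$ be the largest dimension of an $\mathbb F_q$-subspace $W\subseteq \mathbb F_{q^n}$ such that $B(u,w)=0$ for all $u,w\in W$, and let $M_B$ be the largest cardinality of a set $E\subseteq\mathbb F_{q^n}$ such that $B(u,w)=0$ for all $u,w\in E$ with $u\neq w$. If $q$ is odd, let $\chi_q$ be the quadratic character of $\mathbb F_q$ ($\chi_q(a)=1$ if $a\in\mathbb F_q^*$ is a square and $\chi_q(a)=-1$ if $a\in\mathbb F_q^*$ is not), and let $\chi_q(B)=\prod_{i=1}^n\chi_q(a_i)\in\{\pm1\}$, where $\sum_{i=1}^n a_iw_i^2$ with $a_i\in\mathbb F_q^*$ is any diagonalization of the quadratic form $w\mapsto B(w,w)$ (the product does not depend on the diagonalization). Then the following hold. 1. Suppose that $q$ is odd. Then $M_B=q^{t(B)}+n-2t(B)$, where $t(B)=\frac{n-1}{2}$ if $n$ is odd, and $$t(B)=\frac{n+\chi_q(B)\cdot\chi_q(-1)^{n/2}-1}{2}\in\left\{\frac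 n2,\ \frac n2-1\right\}$$ if $n$ is even. 2. If $q=2$ and $t(B)\le 2$, then $M_B\le n+1$. 3. If $q$ is even and either $q>2$ or $t(B)\ge 3$, then $M_B\le q^{t(B)}+n-2t(B)$ and $t(B)\le n/2$. -/

import Mathlib

/-- The set of dimensions of totally isotropic subspaces of `V`: subspaces `W` with
`B u w = 0` for all `u, w ∈ W`. -/
def isotropicDims {F V : Type*} [Field F] [AddCommGroup V] [Module F V]
    (B : LinearMap.BilinForm F V) : Set ℕ :=
  {d | ∃ W : Submodule F V, Module.finrank F W = d ∧ ∀ u ∈ W, ∀ w ∈ W, B u w = 0}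

/-- `t(B)`: the largest dimension of a totally isotropic subspace. -/
noncomputable def maxIsotropicDim {F V : Type*} [Field F] [AddCommGroup V] [Module F V]
    (B : LinearMap.BilinForm F V) : ℕ :=
  sSup (isotropicDims B)

/-- The set of cardinalities of finite sets `E ⊆ V` with `B u w = 0` for all distinct
`u, w ∈ E`. -/
def orthogonalCards {F V : Type*} [Field F] [AddCommGroup V] [Module F V]
    (B : LinearMap.BilinForm F V) : Set ℕ :=
  {m | ∃ E : Finset V, E.card = m ∧ ∀ u ∈ E, ∀ w ∈ E, u ≠ w → B u w = 0}

/-- `M_B`: the largest cardinality of a pairwise `B`-orthogonal set. -/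
noncomputable def maxOrthogonalCard {F V : Type*} [Field F] [AddCommGroup V] [Module F V]
    (B : LinearMap.BilinForm F V) : ℕ :=
  sSup (orthogonalCards B)

/-- The product of the quadratic characters of the diagonal coefficients of `w ↦ B w w` in the
coordinates given by a family `v` (used when `v` is a `B`-orthogonal basis). -/
noncomputable def diagChar {F V : Type*} [Field F] [Fintype F] [DecidableEq F]
    [AddCommGroup V] [Module F V] (B : LinearMap.BilinForm F V) {m : ℕ} (v : Fin m → V) : ℤ :=
  ∏ i, quadraticChar F (B (v i) (v i))

open Classical in
/-- `χ_q(B)`: the value of `diagChar B v` for a `B`-orthogonal basis `v` of `V`. For `B` symmetric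
and `q` odd such a basis exists and the value does not depend on it, see `formChar_eq`.
(The value is `1` by convention if there is no `B`-orthogonal basis.) -/
noncomputable def formChar {F V : Type*} [Field F] [Fintype F] [DecidableEq F]
    [AddCommGroup V] [Module F V] (B : LinearMap.BilinForm F V) : ℤ :=
  if h : ∃ v : Module.Basis (Fin (Module.finrank F V)) F V, B.IsOrthoᵢ v then
    diagChar B h.choose
  else 1

/-- `maxIsotropicDim B` is attained and maximal. -/
theorem isGreatest_maxIsotropicDim {F V : Type*} [Field F] [AddCommGroup V] [Module F V]
    [FiniteDimensional F V] (B : LinearMap.BilinForm F V) :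
    IsGreatest (isotropicDims B) (maxIsotropicDim B) := by
  have hb : BddAbove (isotropicDims B) := by
    refine ⟨Module.finrank F V, ?_⟩
    rintro d ⟨W, rfl, -⟩
    exact Submodule.finrank_le W
  have hne : (isotropicDims B).Nonempty := by
    refine ⟨_, ⊥, rfl, ?_⟩
    intro u hu w _
    rw [(Submodule.mem_bot F).1 hu]
    simp
  exact ⟨Nat.sSup_mem hne hb, fun d hd => le_csSup hb hd⟩

/-- `maxOrthogonalCard B` is attained and maximal. -/
theorem isGreatest_maxOrthogonalCard {F V : Type*} [Field F] [AddCommGroup V] [Module F V]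
    [Finite V] (B : LinearMap.BilinForm F V) :
    IsGreatest (orthogonalCards B) (maxOrthogonalCard B) := by
  have hb : BddAbove (orthogonalCards B) := by
    have := Fintype.ofFinite V
    refine ⟨Fintype.card V, ?_⟩
    rintro d ⟨E, rfl, -⟩
    exact Finset.card_le_univ E
  have hne : (orthogonalCards B).Nonempty := ⟨0, ∅, by simp⟩
  exact ⟨Nat.sSup_mem hne hb, fun d hd => le_csSup hb hd⟩

/-- For an orthogonal basis, `diagChar` is the quadratic character of the Gram determinant. -/
theorem diagChar_eq_det {F V : Type*} [Field F] [Fintype F] [DecidableEq F]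
    [AddCommGroup V] [Module F V] (B : LinearMap.BilinForm F V) {m : ℕ}
    (v : Module.Basis (Fin m) F V) (hv : B.IsOrthoᵢ v) :
    diagChar B v = quadraticChar F (LinearMap.BilinForm.toMatrix v B).det := by
  have h : LinearMap.BilinForm.toMatrix v B = Matrix.diagonal fun i => B (v i) (v i) := by
    ext i j
    rw [LinearMap.BilinForm.toMatrix_apply]
    by_cases hij : i = j
    · subst hij; simp
    · rw [Matrix.diagonal_apply_ne _ hij]
      exact hv hij
  rw [h, Matrix.det_diagonal, map_prod, diagChar]

/-- Independence of the diagonalization: `formChar B` is computed by every orthogonal basis. -/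
theorem formChar_eq {F V : Type*} [Field F] [Fintype F] [DecidableEq F]
    [AddCommGroup V] [Module F V] (B : LinearMap.BilinForm F V)
    (v : Module.Basis (Fin (Module.finrank F V)) F V) (hv : B.IsOrthoᵢ v) :
    formChar B = diagChar B v := by
  have h : ∃ v : Module.Basis (Fin (Module.finrank F V)) F V, B.IsOrthoᵢ v := ⟨v, hv⟩
  rw [formChar, dif_pos h, diagChar_eq_det B _ h.choose_spec, diagChar_eq_det B v hv,
    ← LinearMap.BilinForm.toMatrix_mul_basis_toMatrix v h.choose B, Matrix.det_mul,
    Matrix.det_mul, Matrix.det_transpose, map_mul, map_mul]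
  have hu : (v.toMatrix h.choose).det ≠ 0 := by
    have := congrArg Matrix.det (v.toMatrix_mul_toMatrix_flip h.choose)
    rw [Matrix.det_mul, Matrix.det_one] at this
    exact left_ne_zero_of_mul_eq_one this
  have hs := quadraticChar_sq_one hu
  linear_combination
    (quadraticChar F (LinearMap.BilinForm.toMatrix v B).det) * hs

/-- For `q` odd, a symmetric form has an orthogonal basis. -/
theorem exists_orthogonalBasis_of_odd {F V : Type*} [Field F] [Fintype F]
    [AddCommGroup V] [Module F V] [FiniteDimensional F V] (B : LinearMap.BilinForm F V)
    (hB : B.IsSymm) (hq : Odd (Fintype.card F)) :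
    ∃ v : Module.Basis (Fin (Module.finrank F V)) F V, B.IsOrthoᵢ v := by
  have h2 : ringChar F ≠ 2 := by
    intro h
    have := FiniteField.even_card_of_char_two h
    rw [Nat.odd_iff] at hq
    omega
  have : Invertible (2 : F) := invertibleOfNonzero (Ring.two_ne_zero h2)
  exact LinearMap.BilinForm.exists_orthogonal_basis ⟨fun x y => hB.eq x y⟩

/-! Split an orthogonal set `E` into its vectors with `B u u = 0` and the others. The former span a
totally isotropic space of some dimension `s ≤ t`, so there are at most `q ^ s` of them. The latter
are independent and, together with that span, lie in its orthogonal complement, of dimension `n -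
s`, so there are at most `n - 2s` of them. Thus `M_B ≤ q ^ s + n - 2s`
(`exists_maxOrthogonalCard_le`), and the upper bounds follow by comparing `q ^ s - 2s` with its
value at `t`.

For `q` odd the bound is attained by a maximal isotropic `W` together with an orthogonal basis of an
anisotropic complement `U` of `W` in `Wᗮ` (`le_maxOrthogonalCard_of_odd`). An anisotropic space has
dimension at most 2, so `n - 2t ∈ {0, 1, 2}`; for `n` even, the Gram determinant modulo squares
tells 0 from 2 (`finrank_sub_two_mul_maxIsotropicDim_of_odd`). -/

open Module

/-! ### Isotropic subspaces and the upper bound for orthogonal sets. -/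

section Bounds

variable {F V : Type*} [Field F] [AddCommGroup V] [Module F V] [FiniteDimensional F V]
  {B : LinearMap.BilinForm F V}

/-- A totally isotropic subspace and a finite orthogonal family of anisotropic vectors orthogonal
to it satisfy `2 dim W + |S| ≤ dim V`. -/
theorem two_mul_finrank_add_card_le (hsymm : B.IsSymm) (hnd : B.Nondegenerate)
    (W : Submodule F V) (hW : ∀ u ∈ W, ∀ w ∈ W, B u w = 0) (S : Finset V)
    (hS : ∀ u ∈ S, ∀ w ∈ S, u ≠ w → B u w = 0) (hS0 : ∀ u ∈ S, B u u ≠ 0)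
    (hWS : ∀ u ∈ S, ∀ w ∈ W, B u w = 0) :
    2 * finrank F W + S.card ≤ finrank F V := by
  have hli : LinearIndependent F (fun x : S => (x : V)) :=
    LinearMap.BilinForm.linearIndependent_of_iIsOrtho (B := B)
      (fun i j hij => hS i i.2 j j.2 (fun h => hij (Subtype.ext h))) (fun i => hS0 i i.2)
  have hK : finrank F (Submodule.span F (S : Set V)) = S.card := finrank_span_finset_eq_card hli
  set K := Submodule.span F (S : Set V)
  have hKW : ∀ x ∈ K, ∀ w ∈ W, B x w = 0 := by
    intro x hx w hw
    have hle : K ≤ LinearMap.ker (B.flip w) := Submodule.span_le.2 fun u hu => hWS u hu w hw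
    exact hle hx
  have hdisj : W ⊓ K = ⊥ := by
    rw [eq_bot_iff]
    rintro x ⟨hxW, hxK⟩
    obtain ⟨c, -, rfl⟩ := Submodule.mem_span_finset.1 hxK
    rw [Submodule.mem_bot]
    -- Pairing `x ∈ W` with `a ∈ S` gives 0 and isolates the coefficient of `a`, since `B a a ≠ 0`.
    refine Finset.sum_eq_zero fun a ha => ?_
    have h := hWS a ha _ hxW
    rw [map_sum, Finset.sum_eq_single_of_mem a ha] at h
    · rw [map_smul, smul_eq_mul] at h
      rw [(mul_eq_zero.1 h).resolve_right (hS0 a ha), zero_smul]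
    · intro b hb hba
      rw [map_smul, hS a ha b hb hba.symm, smul_zero]
  have hle : W ⊔ K ≤ B.orthogonal W := by
    refine sup_le (fun w hw u hu => hW u hu w hw) (fun x hx u hu => ?_)
    change B u x = 0
    rw [hsymm.eq]
    exact hKW x hx u hu
  have h1 := Submodule.finrank_mono hle
  have h2 := Submodule.finrank_sup_add_finrank_inf_eq W K
  rw [hdisj, finrank_bot, hK] at h2
  rw [LinearMap.BilinForm.finrank_orthogonal hnd] at h1
  have := W.finrank_le
  omega

theorem two_mul_maxIsotropicDim_le (hsymm : B.IsSymm) (hnd : B.Nondegenerate) :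
    2 * maxIsotropicDim B ≤ finrank F V := by
  obtain ⟨W, hWd, hW⟩ := (isGreatest_maxIsotropicDim B).1
  have := two_mul_finrank_add_card_le hsymm hnd W hW ∅ (by simp) (by simp) (by simp)
  simpa [hWd] using this

/-- Here `s` is the dimension of the span of the isotropic vectors of an optimal set. The terms in
`s` are kept on both sides to avoid truncated subtraction. -/
theorem exists_maxOrthogonalCard_le [Fintype F] (hsymm : B.IsSymm) (hnd : B.Nondegenerate) :
    ∃ s ≤ maxIsotropicDim B,
      maxOrthogonalCard B + 2 * s ≤ Fintype.card F ^ s + finrank F V := by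
  classical
  have : Finite V := Module.finite_of_finite F
  obtain ⟨E, hEc, hE⟩ := (isGreatest_maxOrthogonalCard B).1
  set E₀ := E.filter fun u => B u u = 0
  set E₁ := E.filter fun u => ¬ B u u = 0
  have hcard : E₀.card + E₁.card = E.card := Finset.card_filter_add_card_filter_not _
  have hE₀ : ∀ u ∈ E, ∀ w ∈ E₀, B u w = 0 := by
    intro u hu w hw
    obtain ⟨hw, hw0⟩ := Finset.mem_filter.1 hw
    by_cases h : u = w
    · rwa [h]
    · exact hE u hu w hw h
  have hspan : ∀ u ∈ E, ∀ w ∈ Submodule.span F (E₀ : Set V), B u w = 0 := by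
    intro u hu w hw
    have hle : Submodule.span F (E₀ : Set V) ≤ LinearMap.ker (B u) :=
      Submodule.span_le.2 fun w hw => hE₀ u hu w hw
    exact hle hw
  have hW : ∀ u ∈ Submodule.span F (E₀ : Set V), ∀ w ∈ Submodule.span F (E₀ : Set V),
      B u w = 0 := by
    intro u hu w hw
    have hle : Submodule.span F (E₀ : Set V) ≤ LinearMap.ker (B.flip w) :=
      Submodule.span_le.2 fun u hu => hspan u (Finset.mem_filter.1 hu).1 w hw
    exact hle hu
  refine ⟨finrank F (Submodule.span F (E₀ : Set V)),
    (isGreatest_maxIsotropicDim B).2 ⟨_, rfl, hW⟩, ?_⟩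
  have h1 := two_mul_finrank_add_card_le hsymm hnd _ hW E₁
    (fun u hu w hw => hE u (Finset.mem_filter.1 hu).1 w (Finset.mem_filter.1 hw).1)
    (fun u hu => (Finset.mem_filter.1 hu).2) (fun u hu => hspan u (Finset.mem_filter.1 hu).1)
  have h2 : E₀.card ≤ Fintype.card F ^ finrank F (Submodule.span F (E₀ : Set V)) := by
    rw [← Nat.card_eq_fintype_card, ← Module.natCard_eq_pow_finrank]
    have := Nat.card_mono (Set.toFinite _) (Submodule.subset_span (R := F) (s := (E₀ : Set V)))
    simpa using this
  omega

/-- A maximal totally isotropic subspace `W` and an anisotropic complement of `W` in `Wᗮ`. -/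
theorem exists_maximal_isotropic_anisotropic (hsymm : B.IsSymm) (hnd : B.Nondegenerate) :
    ∃ W U : Submodule F V, finrank F W = maxIsotropicDim B ∧
      (∀ u ∈ W, ∀ w ∈ W, B u w = 0) ∧ (∀ u ∈ U, ∀ w ∈ W, B u w = 0) ∧
      finrank F U + 2 * maxIsotropicDim B = finrank F V ∧ ∀ u ∈ U, B u u = 0 → u = 0 := by
  obtain ⟨W, hWd, hW⟩ := (isGreatest_maxIsotropicDim B).1
  have hWo : W ≤ B.orthogonal W := fun w hw u hu => hW u hu w hw
  obtain ⟨U, hinf, hsup⟩ := IsModularLattice.exists_disjoint_and_sup_eq hWo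
  have hUo : U ≤ B.orthogonal W := hsup ▸ le_sup_right
  have hUW : ∀ u ∈ U, ∀ w ∈ W, B u w = 0 := fun u hu w hw => by
    rw [hsymm.eq]
    exact hUo hu w hw
  refine ⟨W, U, hWd, hW, hUW, ?_, ?_⟩
  · have h1 := Submodule.finrank_sup_add_finrank_inf_eq W U
    rw [hinf.eq_bot, hsup, finrank_bot, LinearMap.BilinForm.finrank_orthogonal hnd] at h1
    have := two_mul_maxIsotropicDim_le hsymm hnd
    omega
  · intro u hu h0
    -- An isotropic `u ∈ U` could be adjoined to `W`; maximality then forces `u ∈ W ⊓ U = ⊥`.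
    have hiso : ∀ x ∈ W ⊔ Submodule.span F {u}, ∀ y ∈ W ⊔ Submodule.span F {u}, B x y = 0 := by
      intro x hx y hy
      obtain ⟨w, hw, z, hz, rfl⟩ := Submodule.mem_sup.1 hx
      obtain ⟨w', hw', z', hz', rfl⟩ := Submodule.mem_sup.1 hy
      obtain ⟨a, rfl⟩ := Submodule.mem_span_singleton.1 hz
      obtain ⟨b, rfl⟩ := Submodule.mem_span_singleton.1 hz'
      have hwu : B w u = 0 := by rw [hsymm.eq]; exact hUW u hu w hw
      simp only [map_add, LinearMap.add_apply, map_smul, LinearMap.smul_apply, smul_eq_mul,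
        hW w hw w' hw', hUW u hu w' hw', hwu, h0, mul_zero, add_zero]
    have hle : finrank F ↥(W ⊔ Submodule.span F {u}) ≤ finrank F W :=
      hWd.symm ▸ (isGreatest_maxIsotropicDim B).2 ⟨W ⊔ Submodule.span F {u}, rfl, hiso⟩
    have heq := Submodule.eq_of_le_of_finrank_le le_sup_left hle
    have huW : u ∈ W := heq ▸ Submodule.mem_sup_right (Submodule.mem_span_singleton_self u)
    exact Submodule.disjoint_def.1 hinf u huW hu

end Bounds

/-! ### Monotonicity of `q ^ s - 2s`. -/

theorem pow_add_two_mul_le_of_three_le {q s t : ℕ} (hq : 3 ≤ q) (hst : s ≤ t) :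
    q ^ s + 2 * t ≤ q ^ t + 2 * s := by
  induction t, hst using Nat.le_induction with
  | base => exact le_rfl
  | succ t _ ih =>
    have : 1 ≤ q ^ t := Nat.one_le_pow _ _ (by omega)
    rw [pow_succ]
    nlinarith

/-- The values of `2 ^ s - 2s` are 1, 0, 0, 2, 8, ...: monotone only from `s = 1`, and the value at
0 is exceeded only from 3 on. Hence the special role of `t ≤ 2` when `q = 2`. -/
theorem two_pow_add_two_mul_le_of_one_le {s t : ℕ} (hs : 1 ≤ s) (hst : s ≤ t) :
    2 ^ s + 2 * t ≤ 2 ^ t + 2 * s := by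
  induction t, hst using Nat.le_induction with
  | base => exact le_rfl
  | succ t hst ih =>
    have : 2 ^ 1 ≤ 2 ^ t := Nat.pow_le_pow_right (by omega) (by omega)
    rw [pow_succ]
    omega

theorem two_pow_add_two_mul_le_of_three_le {s t : ℕ} (ht : 3 ≤ t) (hst : s ≤ t) :
    2 ^ s + 2 * t ≤ 2 ^ t + 2 * s := by
  rcases Nat.eq_zero_or_pos s with rfl | hs
  · have := two_pow_add_two_mul_le_of_one_le (by omega) ht
    omega
  · exact two_pow_add_two_mul_le_of_one_le hs hst

/-! ### Gram determinants modulo squares. -/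

section Gram

variable {F V : Type*} [Field F] [AddCommGroup V] [Module F V]

/-- The Gram matrix in a basis adapted to a direct sum decomposition, as a block matrix. -/
theorem toMatrix_prodEquivOfIsCompl (B : LinearMap.BilinForm F V) {p r : Submodule F V}
    (h : IsCompl p r) {ι κ : Type*} [Fintype ι] [Fintype κ] [DecidableEq ι] [DecidableEq κ]
    (b : Basis ι F p) (c : Basis κ F r) :
    LinearMap.BilinForm.toMatrix ((b.prod c).map (Submodule.prodEquivOfIsCompl p r h)) B =
      Matrix.fromBlocks (Matrix.of fun i j => B (b i) (b j)) (Matrix.of fun i j => B (b i) (c j))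
        (Matrix.of fun i j => B (c i) (b j)) (Matrix.of fun i j => B (c i) (c j)) := by
  ext i j
  rcases i with i | i <;> rcases j with j | j <;>
    simp [LinearMap.BilinForm.toMatrix_apply]

/-- A block column operation of determinant 1 makes the matrix block triangular with diagonal blocks
`-A` and `Aᵀ`. -/
theorem det_fromBlocks_zero_transpose {ι : Type*} [Fintype ι] [DecidableEq ι]
    (A C : Matrix ι ι F) :
    (Matrix.fromBlocks 0 A A.transpose C).det = (-1) ^ Fintype.card ι * A.det ^ 2 := by
  have h1 : (Matrix.fromBlocks (1 : Matrix ι ι F) (1 : Matrix ι ι F) (-1) (0 : Matrix ι ι F)).det = 1 := by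
    rw [Matrix.det_fromBlocks_one₁₁]; simp
  have h2 : Matrix.fromBlocks 0 A A.transpose C * Matrix.fromBlocks (1 : Matrix ι ι F) 1 (-1) 0 =
      Matrix.fromBlocks (-A) 0 (A.transpose - C) A.transpose := by
    rw [Matrix.fromBlocks_multiply]
    simp [sub_eq_add_neg]
  have h3 := congrArg Matrix.det h2
  rw [Matrix.det_mul, h1, mul_one, Matrix.det_fromBlocks_zero₁₂, Matrix.det_neg,
    Matrix.det_transpose] at h3
  rw [h3]
  ring

variable [Fintype F] [DecidableEq F]

/-- A change of basis multiplies the determinant by a nonzero square. Arbitrary index types allow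
bases indexed by a sum, adapted to a decomposition. -/
theorem quadraticChar_det_toMatrix_eq (B : LinearMap.BilinForm F V) {ι κ : Type*} [Fintype ι]
    [DecidableEq ι] [Fintype κ] [DecidableEq κ] (b : Basis ι F V) (c : Basis κ F V) :
    quadraticChar F (LinearMap.BilinForm.toMatrix b B).det =
      quadraticChar F (LinearMap.BilinForm.toMatrix c B).det := by
  let e := b.indexEquiv c
  have hre : (LinearMap.BilinForm.toMatrix b B).det =
      (LinearMap.BilinForm.toMatrix (b.reindex e) B).det := by
    rw [← Matrix.det_submatrix_equiv_self e.symm]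
    congr 1
    ext i j
    simp [LinearMap.BilinForm.toMatrix_apply]
  rw [hre, ← LinearMap.BilinForm.toMatrix_mul_basis_toMatrix c (b.reindex e) B, Matrix.det_mul,
    Matrix.det_mul, Matrix.det_transpose, map_mul, map_mul]
  have hu : (c.toMatrix (b.reindex e)).det ≠ 0 := by
    have := congrArg Matrix.det (c.toMatrix_mul_toMatrix_flip (b.reindex e))
    rw [Matrix.det_mul, Matrix.det_one] at this
    exact left_ne_zero_of_mul_eq_one this
  linear_combination
    (quadraticChar F (LinearMap.BilinForm.toMatrix c B).det) * quadraticChar_sq_one hu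

theorem formChar_eq_quadraticChar_det [FiniteDimensional F V] {B : LinearMap.BilinForm F V}
    (hsymm : B.IsSymm) (hq : Odd (Fintype.card F)) {ι : Type*} [Fintype ι] [DecidableEq ι]
    (b : Basis ι F V) :
    formChar B = quadraticChar F (LinearMap.BilinForm.toMatrix b B).det := by
  obtain ⟨v, hv⟩ := exists_orthogonalBasis_of_odd B hsymm hq
  rw [formChar_eq B v hv, diagChar_eq_det B v hv, quadraticChar_det_toMatrix_eq B v b]

/-- Against any complement of `W`, the Gram matrix has a zero block on `W`, so its determinant is
`(-1) ^ dim W` times a square; no hyperbolic basis is needed. -/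
theorem formChar_of_lagrangian [FiniteDimensional F V] {B : LinearMap.BilinForm F V}
    (hsymm : B.IsSymm) (hnd : B.Nondegenerate) (hq : Odd (Fintype.card F))
    (W : Submodule F V) (hW : ∀ u ∈ W, ∀ w ∈ W, B u w = 0)
    (hdim : finrank F V = 2 * finrank F W) :
    formChar B = quadraticChar F (-1) ^ finrank F W := by
  obtain ⟨W', hc⟩ := W.exists_isCompl
  have hadd := Submodule.finrank_add_eq_of_isCompl hc
  let b := finBasis F W
  let c := finBasisOfFinrankEq F W' (show finrank F W' = finrank F W by omega)
  let A : Matrix (Fin (finrank F W)) (Fin (finrank F W)) F := Matrix.of fun i j => B (b i) (c j)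
  have hdet : (LinearMap.BilinForm.toMatrix
      ((b.prod c).map (Submodule.prodEquivOfIsCompl W W' hc)) B).det =
        (-1) ^ finrank F W * A.det ^ 2 := by
    rw [toMatrix_prodEquivOfIsCompl]
    have h0 : (Matrix.of fun i j => B (b i) (b j)) = 0 := by
      ext i j
      exact hW _ (b i).2 _ (b j).2
    have hA : (Matrix.of fun i j => B (c i) (b j)) = A.transpose := by
      ext i j
      exact hsymm.eq _ _
    rw [h0, hA, det_fromBlocks_zero_transpose, Fintype.card_fin]
  have hne := (LinearMap.BilinForm.nondegenerate_iff_det_ne_zero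
    ((b.prod c).map (Submodule.prodEquivOfIsCompl W W' hc))).1 hnd
  rw [hdet] at hne
  have hA0 : A.det ≠ 0 := by
    intro h
    simp [h] at hne
  rw [formChar_eq_quadraticChar_det hsymm hq
      ((b.prod c).map (Submodule.prodEquivOfIsCompl W W' hc)), hdet, map_mul, map_pow, map_pow,
    quadraticChar_sq_one hA0, mul_one]

theorem formChar_eq_mul_restrict [FiniteDimensional F V] {B : LinearMap.BilinForm F V}
    (hsymm : B.IsSymm) (hq : Odd (Fintype.card F)) {U : Submodule F V}
    (h : IsCompl U (B.orthogonal U)) :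
    formChar B = formChar (B.restrict U) * formChar (B.restrict (B.orthogonal U)) := by
  have hs : ∀ X : Submodule F V, (B.restrict X).IsSymm := fun X => ⟨fun x y => hsymm.eq x y⟩
  let b := finBasis F U
  let c := finBasis F (B.orthogonal U)
  rw [formChar_eq_quadraticChar_det (hs U) hq b, formChar_eq_quadraticChar_det (hs _) hq c,
    formChar_eq_quadraticChar_det hsymm hq
      ((b.prod c).map (Submodule.prodEquivOfIsCompl U _ h)), ← map_mul,
    toMatrix_prodEquivOfIsCompl]
  have h0 : (Matrix.of fun i j => B (b i) (c j)) = 0 := by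
    ext i j
    exact (c j).2 _ (b i).2
  rw [h0, Matrix.det_fromBlocks_zero₁₂]
  congr 3 <;> ext i j <;> simp [LinearMap.BilinForm.toMatrix_apply]

end Gram

/-! ### Odd `q`: anisotropic spaces, attaining the bound, and the value of `t`. -/

section Odd

variable {F V : Type*} [Field F] [Fintype F] [AddCommGroup V] [Module F V]
  [FiniteDimensional F V] {B : LinearMap.BilinForm F V}

/-- Pigeonhole: `a x²` and `-(b y² + c)` each take `(q + 1) / 2` values, so they share one. -/
theorem exists_isotropic_combination {a b : F} (ha : a ≠ 0) (hb : b ≠ 0) (c : F)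
    (hq : Odd (Fintype.card F)) : ∃ x y : F, a * x ^ 2 + b * y ^ 2 + c = 0 := by
  obtain ⟨x, y, h⟩ := FiniteField.exists_root_sum_quadratic
    (f := Polynomial.C a * Polynomial.X ^ 2 + Polynomial.C 0 * Polynomial.X + Polynomial.C 0)
    (g := Polynomial.C b * Polynomial.X ^ 2 + Polynomial.C 0 * Polynomial.X + Polynomial.C c)
    (Polynomial.degree_quadratic ha) (Polynomial.degree_quadratic hb) (Nat.odd_iff.1 hq)
  refine ⟨x, y, ?_⟩
  simpa [add_assoc] using h

theorem finrank_le_two_of_anisotropic (hsymm : B.IsSymm) (hq : Odd (Fintype.card F))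
    (han : ∀ u, B u u = 0 → u = 0) : finrank F V ≤ 2 := by
  by_contra! hn
  obtain ⟨v, hv⟩ := exists_orthogonalBasis_of_odd B hsymm hq
  let i : Fin (finrank F V) := ⟨0, by omega⟩
  let j : Fin (finrank F V) := ⟨1, by omega⟩
  let k : Fin (finrank F V) := ⟨2, by omega⟩
  have h0 : ∀ l, B (v l) (v l) ≠ 0 := fun l h => v.ne_zero l (han _ h)
  have ho : ∀ l m, l ≠ m → B (v l) (v m) = 0 := fun l m h => hv h
  have hij : i ≠ j := by simp [i, j]
  have hik : i ≠ k := by simp [i, k]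
  have hjk : j ≠ k := by simp [j, k]
  obtain ⟨x, y, hxy⟩ := exists_isotropic_combination (h0 i) (h0 j) (B (v k) (v k)) hq
  -- The coefficient 1 on `v k` keeps this isotropic vector nonzero.
  have hz := han (x • v i + y • v j + v k) (by
    simp only [map_add, LinearMap.add_apply, map_smul, LinearMap.smul_apply, smul_eq_mul,
      ho i j hij, ho i k hik, ho j k hjk, ho j i hij.symm, ho k i hik.symm, ho k j hjk.symm]
    linear_combination hxy)
  have := congrArg (fun w => v.repr w k) hz
  simp [hik, hjk] at this

theorem formChar_of_anisotropic_of_finrank_eq_two [DecidableEq F] (hsymm : B.IsSymm)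
    (hq : Odd (Fintype.card F)) (han : ∀ u, B u u = 0 → u = 0) (hn : finrank F V = 2) :
    formChar B = -quadraticChar F (-1) := by
  obtain ⟨v, hv⟩ := exists_orthogonalBasis_of_odd B hsymm hq
  let v' := v.reindex (finCongr hn)
  have h0 : ∀ l, B (v' l) (v' l) ≠ 0 := fun l h => v'.ne_zero l (han _ h)
  have ho : ∀ l m, l ≠ m → B (v' l) (v' m) = 0 := by
    intro l m h
    simp only [v', Basis.reindex_apply]
    exact hv (fun h' => h ((finCongr hn).symm.injective h'))
  rw [formChar_eq_quadraticChar_det hsymm hq v', Matrix.det_fin_two]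
  simp only [LinearMap.BilinForm.toMatrix_apply]
  rw [ho 0 1 (by decide), zero_mul, sub_zero]
  set a := B (v' 0) (v' 0) with ha
  set b := B (v' 1) (v' 1) with hb
  have hab : a * b ≠ 0 := mul_ne_zero (h0 0) (h0 1)
  -- If `-ab = c²`, then `c • v' 0 + a • v' 1` is isotropic, with value `a (c² + ab) = 0`, and
  -- nonzero since `a ≠ 0`.
  have hns : quadraticChar F (-1 * (a * b)) = -1 := by
    rw [quadraticChar_neg_one_iff_not_isSquare]
    rintro ⟨c, hc⟩
    have hz := han (c • v' 0 + a • v' 1) (by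
      simp only [map_add, LinearMap.add_apply, map_smul, LinearMap.smul_apply, smul_eq_mul,
        ho 0 1 (by decide), ho 1 0 (by decide), ← ha, ← hb]
      linear_combination (-a) * hc)
    have := congrArg (fun w => v'.repr w 1) hz
    simp at this
    exact h0 0 this
  rw [map_mul] at hns
  have hs : quadraticChar F (-1) ^ 2 = 1 := quadraticChar_sq_one (neg_ne_zero.2 one_ne_zero)
  linear_combination quadraticChar F (-1) * hns - quadraticChar F (a * b) * hs

theorem le_maxOrthogonalCard_of_odd (hsymm : B.IsSymm) (hnd : B.Nondegenerate)
    (hq : Odd (Fintype.card F)) :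
    Fintype.card F ^ maxIsotropicDim B + finrank F V ≤
      maxOrthogonalCard B + 2 * maxIsotropicDim B := by
  classical
  have : Finite V := Module.finite_of_finite F
  obtain ⟨W, U, hWd, hW, hUW, hdim, han⟩ := exists_maximal_isotropic_anisotropic hsymm hnd
  obtain ⟨v, hv⟩ := exists_orthogonalBasis_of_odd (B.restrict U) ⟨fun x y => hsymm.eq x y⟩ hq
  have hinj : Function.Injective fun i => (v i : V) := Subtype.val_injective.comp v.injective
  let E₀ : Finset V := (Set.toFinite (W : Set V)).toFinset
  let E₁ : Finset V := Finset.univ.image fun i => (v i : V)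
  have h0 : E₀.card = Fintype.card F ^ maxIsotropicDim B := by
    rw [← hWd, ← Nat.card_eq_fintype_card, ← Module.natCard_eq_pow_finrank,
      ← Set.ncard_eq_toFinset_card]
    rfl
  have h1 : E₁.card = finrank F U := by
    rw [Finset.card_image_of_injective _ hinj, Finset.card_univ, Fintype.card_fin]
  have hdisj : Disjoint E₀ E₁ := by
    rw [Finset.disjoint_left]
    intro x hx hx'
    obtain ⟨i, -, rfl⟩ := Finset.mem_image.1 hx'
    have hxW : (v i : V) ∈ W := by simpa [E₀] using hx
    exact v.ne_zero i (Subtype.ext (han _ (v i).2 (hW _ hxW _ hxW)))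
  have hmem : (E₀ ∪ E₁).card ∈ orthogonalCards B := by
    refine ⟨_, rfl, ?_⟩
    intro x hx y hy hxy
    rcases Finset.mem_union.1 hx with hx | hx <;> rcases Finset.mem_union.1 hy with hy | hy
    · exact hW x (by simpa [E₀] using hx) y (by simpa [E₀] using hy)
    · obtain ⟨j, -, rfl⟩ := Finset.mem_image.1 hy
      rw [hsymm.eq]
      exact hUW _ (v j).2 x (by simpa [E₀] using hx)
    · obtain ⟨i, -, rfl⟩ := Finset.mem_image.1 hx
      exact hUW _ (v i).2 y (by simpa [E₀] using hy)
    · obtain ⟨i, -, rfl⟩ := Finset.mem_image.1 hx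
      obtain ⟨j, -, rfl⟩ := Finset.mem_image.1 hy
      exact hv (fun h => hxy (by rw [h]))
  have hle := (isGreatest_maxOrthogonalCard B).2 hmem
  rw [Finset.card_union_of_disjoint hdisj, h0, h1] at hle
  omega

/-- The three cases are `dim U = 0, 1, 2` for the anisotropic part `U`. In the last, `V` is the
orthogonal sum of `U` and `Uᗮ`, and `W` is Lagrangian in `Uᗮ`, so the characters of the two pieces
multiply. -/
theorem finrank_sub_two_mul_maxIsotropicDim_of_odd [DecidableEq F] (hsymm : B.IsSymm)
    (hnd : B.Nondegenerate) (hq : Odd (Fintype.card F)) :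
    (finrank F V = 2 * maxIsotropicDim B ∧
        formChar B = quadraticChar F (-1) ^ maxIsotropicDim B) ∨
      finrank F V = 2 * maxIsotropicDim B + 1 ∨
      (finrank F V = 2 * maxIsotropicDim B + 2 ∧
        formChar B = -quadraticChar F (-1) ^ (maxIsotropicDim B + 1)) := by
  obtain ⟨W, U, hWd, hW, hUW, hdim, han⟩ := exists_maximal_isotropic_anisotropic hsymm hnd
  have hrs : ∀ X : Submodule F V, (B.restrict X).IsSymm := fun X => ⟨fun x y => hsymm.eq x y⟩
  have hrefl : B.IsRefl := fun x y h => by rw [hsymm.eq, h]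
  have han' : ∀ u : U, B.restrict U u u = 0 → u = 0 := fun u h => Subtype.ext (han u u.2 h)
  have h2 := finrank_le_two_of_anisotropic (hrs U) hq han'
  rcases (by omega : finrank F U = 0 ∨ finrank F U = 1 ∨ finrank F U = 2) with h | h | h
  · refine Or.inl ⟨by omega, ?_⟩
    rw [← hWd]
    exact formChar_of_lagrangian hsymm hnd hq W hW (by omega)
  · exact Or.inr (Or.inl (by omega))
  · refine Or.inr (Or.inr ⟨by omega, ?_⟩)
    have hdisj : Disjoint U (B.orthogonal U) := Submodule.disjoint_def.2 fun x hx hx' =>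
      han x hx (hx' x hx)
    have hc := (LinearMap.BilinForm.isCompl_orthogonal_iff_disjoint hrefl).2 hdisj
    have hnd' : (B.restrict (B.orthogonal U)).Nondegenerate := by
      refine B.nondegenerate_restrict_of_disjoint_orthogonal hrefl ?_
      rw [LinearMap.BilinForm.orthogonal_orthogonal hnd hrefl]
      exact hdisj.symm
    have hWU : W ≤ B.orthogonal U := fun w hw u hu => hUW u hu w hw
    have hfr : finrank F (W.comap (B.orthogonal U).subtype) = finrank F W :=
      (Submodule.comapSubtypeEquivOfLe hWU).finrank_eq
    have hL := formChar_of_lagrangian (hrs _) hnd' hq (W.comap (B.orthogonal U).subtype)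
      (fun u hu w hw => hW u hu w hw) (by
        rw [hfr, LinearMap.BilinForm.finrank_orthogonal hnd]
        omega)
    rw [formChar_eq_mul_restrict hsymm hq hc, hL,
      formChar_of_anisotropic_of_finrank_eq_two (hrs U) hq han' h, hfr, hWd]
    ring

end Odd

/-! ### Assembly of the three statements. -/

theorem mainTheorem10 {F L : Type*} [Field F] [Fintype F] [DecidableEq F]
    [Field L] [Finite L] [Algebra F L] (q n : ℕ)
    (hq : Fintype.card F = q) (hn : Nat.card L = q ^ n)
    (B : LinearMap.BilinForm F L) (hsymm : B.IsSymm) (hnd : B.Nondegenerate) :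
    (Odd q →
      (maxOrthogonalCard B : ℤ) = (q : ℤ) ^ maxIsotropicDim B + n - 2 * maxIsotropicDim B ∧
      (Odd n → (maxIsotropicDim B : ℚ) = ((n : ℚ) - 1) / 2) ∧
      (Even n →
        (maxIsotropicDim B : ℚ) =
          ((n : ℚ) + (formChar B : ℚ) * (quadraticChar F (-1) : ℚ) ^ (n / 2) - 1) / 2 ∧
        (maxIsotropicDim B : ℚ) ∈ ({(n : ℚ) / 2, (n : ℚ) / 2 - 1} : Set ℚ))) ∧
    (q = 2 → maxIsotropicDim B ≤ 2 → maxOrthogonalCard B ≤ n + 1) ∧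
    (Even q → (2 < q ∨ 3 ≤ maxIsotropicDim B) →
      (maxOrthogonalCard B : ℤ) ≤ (q : ℤ) ^ maxIsotropicDim B + n - 2 * maxIsotropicDim B ∧
      (maxIsotropicDim B : ℚ) ≤ (n : ℚ) / 2) := by
  have : FiniteDimensional F L := Module.finite_iff_finite.2 inferInstance
  have hq2 : 2 ≤ q := hq ▸ Fintype.one_lt_card
  have hfr : finrank F L = n := by
    rw [Module.natCard_eq_pow_finrank (K := F), Nat.card_eq_fintype_card, hq] at hn
    exact Nat.pow_right_injective hq2 hn
  have ht := two_mul_maxIsotropicDim_le hsymm hnd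
  obtain ⟨s, hs, hM⟩ := exists_maxOrthogonalCard_le hsymm hnd
  rw [hfr] at ht
  rw [hfr, hq] at hM
  refine ⟨fun hodd => ?_, ?_, fun _ hcase => ?_⟩
  · have hodd' : Odd (Fintype.card F) := hq ▸ hodd
    have hlow := le_maxOrthogonalCard_of_odd hsymm hnd hodd'
    have hclass := finrank_sub_two_mul_maxIsotropicDim_of_odd hsymm hnd hodd'
    rw [hfr, hq] at hlow
    rw [hfr] at hclass
    have hs2 : (quadraticChar F (-1) : ℚ) ^ 2 = 1 := by
      exact_mod_cast quadraticChar_sq_one (neg_ne_zero.2 (one_ne_zero (α := F)))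
    -- For `n` even, this cancels the factor `χ(-1) ^ (n / 2)` against the same power in `formChar
    -- B`, leaving a sign: `+1` if `n = 2t`, `-1` if `n = 2t + 2`.
    have hpow : ∀ k : ℕ, (quadraticChar F (-1) : ℚ) ^ k * (quadraticChar F (-1) : ℚ) ^ k = 1 := by
      intro k
      rw [← pow_add, ← two_mul, pow_mul, hs2, one_pow]
    refine ⟨?_, ?_, ?_⟩
    · have hmono := pow_add_two_mul_le_of_three_le
        (by obtain ⟨k, rfl⟩ := hodd; omega : 3 ≤ q) hs
      have heq : maxOrthogonalCard B + 2 * maxIsotropicDim B = q ^ maxIsotropicDim B + n := by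
        omega
      have : (maxOrthogonalCard B : ℤ) + 2 * maxIsotropicDim B =
          (q : ℤ) ^ maxIsotropicDim B + n := by exact_mod_cast heq
      linarith
    · intro hn
      have h : n = 2 * maxIsotropicDim B + 1 := by
        rw [Nat.odd_iff] at hn
        omega
      have : (n : ℚ) = 2 * maxIsotropicDim B + 1 := by exact_mod_cast h
      linarith
    · intro hn
      rw [Nat.even_iff] at hn
      rcases hclass with ⟨h, hχ⟩ | h | ⟨h, hχ⟩
      · have hn2 : n / 2 = maxIsotropicDim B := by omega
        have hnq : (n : ℚ) = 2 * maxIsotropicDim B := by exact_mod_cast h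
        have hp := hpow (maxIsotropicDim B)
        refine ⟨?_, Or.inl (by linarith)⟩
        rw [hn2, hχ]
        push_cast
        rw [hp, hnq]
        ring
      · omega
      · have hn2 : n / 2 = maxIsotropicDim B + 1 := by omega
        have hnq : (n : ℚ) = 2 * maxIsotropicDim B + 2 := by exact_mod_cast h
        have hp := hpow (maxIsotropicDim B + 1)
        refine ⟨?_, Or.inr (show _ = _ by linarith)⟩
        rw [hn2, hχ]
        push_cast
        rw [neg_mul, hp, hnq]
        ring
  · rintro rfl ht2
    have : s ≤ 2 := by omega
    -- For `s = 0, 1, 2` the number `2 ^ s - 2s` is at most 1, whence `n + 1`.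
    interval_cases s <;> omega
  · have hmono : q ^ s + 2 * maxIsotropicDim B ≤ q ^ maxIsotropicDim B + 2 * s := by
      rcases hcase with h | h
      · exact pow_add_two_mul_le_of_three_le h hs
      · rcases hq2.lt_or_eq with h' | rfl
        · exact pow_add_two_mul_le_of_three_le h' hs
        · exact two_pow_add_two_mul_le_of_three_le h hs
    have hle : maxOrthogonalCard B + 2 * maxIsotropicDim B ≤ q ^ maxIsotropicDim B + n := by
      omega
    have hleZ : (maxOrthogonalCard B : ℤ) + 2 * maxIsotropicDim B ≤
        (q : ℤ) ^ maxIsotropicDim B + n := by exact_mod_cast hle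
    have htQ : (2 : ℚ) * maxIsotropicDim B ≤ n := by exact_mod_cast ht
    exact ⟨by linarith, by linarith⟩
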